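/- A measurement pattern $t=(V,I,O,A)$ consists of a finite register $V$ of qubits, sets $I,O\subseteq V$ of input and output qubits, and a finite sequence $A$ of commands: entangling operations $E_{i,j}=\Lambda Z_{i,j}$ ($i\neq j$), destructive measurements $M_i^\alpha$ ($\alpha\in\mathbb R$) in the basis $\frac{1}{\sqrt2}(|0\rangle\pm e^{i\alpha}|1\rangle)$ with outcome $s_i\in\{0,1\}$, and corrections $X_i^\sigma$, $Z_i^\sigma$, where $\sigma$ is a sum modulo 2 of outcomes. It is well-formed: no command acts on an already measured qubit, output qubits are not measured, and corrections depend only on outcomes already obtained. Non-input qubits are initialised in $|+\rangle$; unmeasured non-output qubits are discarded at the end. The size of $t$ is the sum over its commands of the number of qubits acted on ($2$ for $E_{i,j}$, $1$ for the other commands). Its depth is the length of a longest subsequence of $A$ in which the domains of any two consecutive commands intersect, where the domain of a command consists of the qubits it acts on and the qubits on whose outcomes it depends. A quantum circuit with unbounded fan-out $(W,I',O',G)$ consists of a finite register $W$, sets $I',O'\subseteq W$, and a finite sequence $G$ of gates $H$, $R_z(\alpha)=\mathrm{diag}(1,e^{i\alpha})$ ($\alpha\in\mathbb R$), $\Lambda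 Z$, and fan-out gates $|y_1,\dots,y_{n-1},x\rangle\mapsto|y_1\oplus x,\dots,y_{n-1}\oplus x,x\rangle$ for arbitrary $n\ge 1$. Non-input qubits are initialised in $|0\rangle$, the gates are applied, and finally the non-output qubits are measured in the standard basis. Its size is the sum over its gates of the number of qubits affected, and its depth is the length of a longest subsequence of $G$ in which any two consecutive gates share a qubit. A circuit implements $t$ if, for some identifications of its inputs with $I$ and its outputs with $O$, and some assignment of distinct non-output qubits of the circuit to the measured qubits of $t$, the following holds for every input state and every tuple $s$ of outcomes of the measurements of $t$: the unnormalised output state of $t$ in the branch $s$ equals the unnormalised output state of the circuit conditioned on the final measurement giving the outcomes $s$ on the assigned qubits (the other non-output qubits being ignored). In particular, the two induce the same quantum channel from inputs to outputs. **Lemma.** There is a constant $C$ such that every well-formed measurement pattern $t$ in which every non-input output qubit is acted on by at least one command can be implemented by a quantum circuit with unbounded fan-out of depth at most $C\cdot\mathrm{depth}(t)$ and size at most $C\cdot\mathrm{size}(t)^2$. -/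

import Mathlib

universe u

namespace OneWay

/-- The length of a longest subsequence of `l` in which any two consecutive elements have
intersecting domains (a longest path of dependent operations). -/
noncomputable def pathDepth {α V : Type*} [DecidableEq V] (dom : α → Finset V) (l : List α) : ℕ :=
  sSup {n : ℕ | ∃ p : List α,
    p.Sublist l ∧ p.IsChain (fun a b => (dom a ∩ dom b).Nonempty) ∧ p.length = n}

/-- The supremum in `pathDepth` is a maximum. -/
theorem pathDepth_isGreatest {α V : Type*} [DecidableEq V] (dom : α → Finset V) (l : List α) :
    IsGreatest {n : ℕ | ∃ p : List α,
      p.Sublist l ∧ p.IsChain (fun a b => (dom a ∩ dom b).Nonempty) ∧ p.length = n}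
      (pathDepth dom l) := by
  have hb : BddAbove {n : ℕ | ∃ p : List α,
      p.Sublist l ∧ p.IsChain (fun a b => (dom a ∩ dom b).Nonempty) ∧ p.length = n} := by
    refine ⟨l.length, ?_⟩
    rintro n ⟨p, hp, -, rfl⟩
    exact hp.length_le
  exact ⟨Nat.sSup_mem ⟨0, [], List.nil_sublist l, List.isChain_nil, rfl⟩ hb,
    fun n hn => le_csSup hb hn⟩

/-! ### Linear algebra on a register of qubits

A register `V` of qubits has the computational basis `V → Bool`; operators are matrices in it. -/

/-- The operator acting as `g` on qubit `i` and as the identity on the other qubits. -/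
noncomputable def onQubit {V : Type*} [Fintype V] [DecidableEq V] (i : V)
    (g : Matrix Bool Bool ℂ) : Matrix (V → Bool) (V → Bool) ℂ :=
  fun x y => if ∀ v, v ≠ i → x v = y v then g (x i) (y i) else 0

noncomputable def hadamardMat : Matrix Bool Bool ℂ :=
  fun a b => (1 / (Real.sqrt 2 : ℂ)) * (if a && b then -1 else 1)

/-- `R_z(α) = diag(1, e^{iα})`. -/
noncomputable def rzMat (α : ℝ) : Matrix Bool Bool ℂ :=
  Matrix.diagonal fun b => if b then Complex.exp (Complex.I * α) else 1

def pauliX : Matrix Bool Bool ℂ :=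
  fun a b => if a = b then 0 else 1

def pauliZ : Matrix Bool Bool ℂ :=
  Matrix.diagonal fun b => if b then -1 else 1

/-- The controlled-`Z` gate on qubits `i` and `j`. -/
def ctrlZ {V : Type*} [DecidableEq V] [Fintype V] (i j : V) :
    Matrix (V → Bool) (V → Bool) ℂ :=
  Matrix.diagonal fun x => if x i && x j then -1 else 1

/-- The fan-out gate: the bit of the source `x` is added modulo 2 to every target in `T`. -/
def fanoutMat {V : Type*} [DecidableEq V] [Fintype V] (x : V) (T : Finset V) :
    Matrix (V → Bool) (V → Bool) ℂ :=
  fun b a => if b = (fun v => if v ∈ T then xor (a v) (a x) else a v) then 1 else 0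

/-- Amplitudes of `|+_α⟩` (for `s = false`) and `|-_α⟩` (for `s = true`). -/
noncomputable def measVec (α : ℝ) (s : Bool) : Bool → ℂ :=
  fun b => (1 / (Real.sqrt 2 : ℂ)) *
    (if b then (if s then -1 else 1) * Complex.exp (Complex.I * α) else 1)

/-- The operator `|s⟩⟨±_α|` of outcome `s`. The measured qubit is destroyed: its place in the
register merely records the outcome. -/
noncomputable def measMat (α : ℝ) (s : Bool) : Matrix Bool Bool ℂ :=
  fun a b => if a = s then star (measVec α s b) else 0

/-- The isometry `|φ⟩ ↦ |φ⟩ ⊗ |a⟩ ⊗ ⋯ ⊗ |a⟩`, where the qubits outside `I` are prepared in the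
one-qubit state with amplitudes `a`. -/
def prepare {V : Type*} [Fintype V] [DecidableEq V] (I : Finset V) (a : Bool → ℂ) :
    Matrix (V → Bool) (I → Bool) ℂ :=
  fun x y => if ∀ i : I, x i = y i then ∏ v ∈ Iᶜ, a (x v) else 0

/-- The basis state of the whole register made of a basis state `y` of the qubits in `O` and a
basis state `z` of the remaining ones. -/
def merge {V : Type*} [DecidableEq V] (O : Finset V) (y : O → Bool) (z : {v // v ∉ O} → Bool) :
    V → Bool :=
  fun v => if h : v ∈ O then y ⟨v, h⟩ else z ⟨v, h⟩

/-- The unnormalised state of the qubits in `O` when a measurement of all the other qubits in the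
standard basis gives `z`. -/
def outBlock {V : Type*} [DecidableEq V] (O : Finset V) (z : {v // v ∉ O} → Bool)
    (M : Matrix (V → Bool) (V → Bool) ℂ) : Matrix (O → Bool) (O → Bool) ℂ :=
  M.submatrix (fun y => merge O y z) (fun y => merge O y z)

/-- The partial trace over the qubits outside `O`. -/
def traceOut {V : Type*} [Fintype V] [DecidableEq V] (O : Finset V)
    (M : Matrix (V → Bool) (V → Bool) ℂ) : Matrix (O → Bool) (O → Bool) ℂ :=
  ∑ z : {v // v ∉ O} → Bool, outBlock O z M

/-! ### Measurement patterns -/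

/-- The commands `E_{i,j}`, `M_i^α`, `X_i^σ` and `Z_i^σ`; a signal `σ` is the set of the qubits
whose outcomes are summed modulo 2. -/
inductive Command (V : Type u) : Type u
  | entangle (i j : V) (h : i ≠ j) : Command V
  | measure (i : V) (α : ℝ) : Command V
  | corrX (i : V) (σ : Finset V) : Command V
  | corrZ (i : V) (σ : Finset V) : Command V

namespace Command

variable {V : Type u} [DecidableEq V]

/-- The qubits that a command acts on. -/
def qubits : Command V → Finset V
  | entangle i j _ => {i, j}
  | measure i _ => {i}
  | corrX i _ => {i}
  | corrZ i _ => {i}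

/-- The qubits that a command acts on or whose outcomes it depends on. -/
def dom : Command V → Finset V
  | entangle i j _ => {i, j}
  | measure i _ => {i}
  | corrX i σ => insert i σ
  | corrZ i σ => insert i σ

/-- The qubits that a command measures. -/
def measured : Command V → Finset V
  | measure i _ => {i}
  | _ => ∅

/-- The outcomes that a command depends on. -/
def signal : Command V → Finset V
  | corrX _ σ => σ
  | corrZ _ σ => σ
  | _ => ∅

/-- The sum modulo 2 of the outcomes in `σ`. -/
def parity (s : V → Bool) (σ : Finset V) : Bool :=
  decide (Odd (σ.filter fun j => s j = true).card)

/-- The operator that a command applies to the register when the outcomes are `s`. -/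
noncomputable def op [Fintype V] (s : V → Bool) : Command V → Matrix (V → Bool) (V → Bool) ℂ
  | entangle i j _ => ctrlZ i j
  | measure i α => onQubit i (measMat α (s i))
  | corrX i σ => if parity s σ then onQubit i pauliX else 1
  | corrZ i σ => if parity s σ then onQubit i pauliZ else 1

end Command

/-- A measurement pattern on the register `V`; `commands` is listed in the order of execution. -/
structure Pattern (V : Type u) where
  inputs : Finset V
  outputs : Finset V
  commands : List (Command V)

/-- Well-formedness of a sequence of commands executed once the qubits in `D` have been measured:
no command acts on a measured qubit, output qubits are not measured, and a correction depends only
on outcomes already obtained. -/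
def WellFormedFrom {V : Type u} [DecidableEq V] (O : Finset V) :
    Finset V → List (Command V) → Prop
  | _, [] => True
  | D, c :: l => Disjoint c.qubits D ∧ Disjoint c.measured O ∧ c.signal ⊆ D ∧
      WellFormedFrom O (D ∪ c.measured) l

namespace Pattern

variable {V : Type u} [DecidableEq V]

def WellFormed (t : Pattern V) : Prop :=
  WellFormedFrom t.outputs ∅ t.commands

/-- The total size of the commands. -/
def size (t : Pattern V) : ℕ :=
  (t.commands.map fun c => c.qubits.card).sum

/-- The quantum depth. -/
noncomputable def depth (t : Pattern V) : ℕ :=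
  pathDepth Command.dom t.commands

/-- The qubits that are measured in the course of the pattern. -/
def measured (t : Pattern V) : Finset V :=
  t.commands.foldr (fun c D => c.measured ∪ D) ∅

/-- The Kraus operator of the branch with outcomes `s`, from the input qubits to the register:
the non-input qubits are prepared in `|+⟩`, then the commands are applied. -/
noncomputable def kraus [Fintype V] (t : Pattern V) (s : t.measured → Bool) :
    Matrix (V → Bool) (t.inputs → Bool) ℂ :=
  t.commands.foldl
    (fun U c => c.op (fun v => if h : v ∈ t.measured then s ⟨v, h⟩ else false) * U)
    (prepare t.inputs fun _ => 1 / (Real.sqrt 2 : ℂ))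

/-- The unnormalised state of the output qubits when the measurements of the pattern, run on the
input state `ρ`, give the outcomes `s`. -/
noncomputable def branch [Fintype V] (t : Pattern V) (s : t.measured → Bool)
    (ρ : Matrix (t.inputs → Bool) (t.inputs → Bool) ℂ) :
    Matrix (t.outputs → Bool) (t.outputs → Bool) ℂ :=
  traceOut t.outputs (t.kraus s * ρ * (t.kraus s).conjTranspose)

end Pattern

/-! ### Quantum circuits with unbounded fan-out -/

inductive Gate (W : Type u) : Type u
  | hadamard (i : W) : Gate W
  | rz (i : W) (α : ℝ) : Gate W
  | cz (i j : W) (h : i ≠ j) : Gate W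
  | fanout (x : W) (T : Finset W) (h : x ∉ T) : Gate W

namespace Gate

variable {W : Type u} [DecidableEq W]

def qubits : Gate W → Finset W
  | hadamard i => {i}
  | rz i _ => {i}
  | cz i j _ => {i, j}
  | fanout x T _ => insert x T

noncomputable def op [Fintype W] : Gate W → Matrix (W → Bool) (W → Bool) ℂ
  | hadamard i => onQubit i hadamardMat
  | rz i α => onQubit i (rzMat α)
  | cz i j _ => ctrlZ i j
  | fanout x T _ => fanoutMat x T

end Gate

/-- A quantum circuit with unbounded fan-out on the register `W`; `gates` is listed in the order
of execution. -/
structure FanoutCircuit (W : Type u) where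
  inputs : Finset W
  outputs : Finset W
  gates : List (Gate W)

namespace FanoutCircuit

variable {W : Type u} [DecidableEq W]

/-- The total number of qubits affected by the gates. -/
def size (c : FanoutCircuit W) : ℕ :=
  (c.gates.map fun g => g.qubits.card).sum

noncomputable def depth (c : FanoutCircuit W) : ℕ :=
  pathDepth Gate.qubits c.gates

/-- The isometry of the circuit, from the input qubits to the register: the non-input qubits are
prepared in `|0⟩`, then the gates are applied. -/
noncomputable def isometry [Fintype W] (c : FanoutCircuit W) :
    Matrix (W → Bool) (c.inputs → Bool) ℂ :=
  c.gates.foldl (fun U g => g.op * U) (prepare c.inputs fun b => if b then 0 else 1)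

/-- The unnormalised state of the output qubits when the final measurement of the non-output
qubits in the standard basis, for the input state `ρ`, gives `z`. -/
noncomputable def branch [Fintype W] (c : FanoutCircuit W) (z : {w // w ∉ c.outputs} → Bool)
    (ρ : Matrix (c.inputs → Bool) (c.inputs → Bool) ℂ) :
    Matrix (c.outputs → Bool) (c.outputs → Bool) ℂ :=
  outBlock c.outputs z (c.isometry * ρ * c.isometry.conjTranspose)

/-- The circuit `c` implements the pattern `t`: up to identifications `inp` of the inputs and `out`
of the outputs, and with the outcome of each measured qubit `j` of `t` read off the final
measurement of the non-output qubit `rd j` of `c`, every tuple `s` of outcomes comes with the same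
(unnormalised) output state for every input. Summing over `s`, the two induce in particular the
same quantum channel from inputs to outputs. -/
def Implements {V : Type u} [Fintype V] [DecidableEq V] [Fintype W]
    (c : FanoutCircuit W) (t : Pattern V) : Prop :=
  ∃ (inp : t.inputs ≃ c.inputs) (out : t.outputs ≃ c.outputs)
    (rd : t.measured ↪ {w // w ∉ c.outputs}),
    ∀ (s : t.measured → Bool) (ρ : Matrix (t.inputs → Bool) (t.inputs → Bool) ℂ),
      t.branch s ρ =
        (∑ z : {w // w ∉ c.outputs} → Bool with (∀ j, z (rd j) = s j),
          c.branch z (ρ.submatrix (fun x => x ∘ inp) (fun x => x ∘ inp))).submatrix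
            (fun y => y ∘ out.symm) (fun y => y ∘ out.symm)

end FanoutCircuit

end OneWay

/-!
A well-formed pattern is simulated by a circuit on its own register, without ancillas.

Measurements are deferred. The measurement `M_i^α` becomes the gates `R_z(-α)` and `H` on `i`, which
rotate the measured basis to the standard one; from then on qubit `i` carries its outcome, and by
well-formedness it only serves as a control. A correction is controlled by the parity of the qubits
that carry its signal `σ`. The parity-controlled `Z` on `i` is the product of the controlled-`Z`
gates on `i` and the elements of `σ`. Since `H` on the target conjugates a controlled-not into a
controlled-`Z`, it equals one fan-out gate with source `i` and targets `σ` between two layers of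
Hadamard gates on `σ` (`seqOp_hadamard_mul_fanoutMat`); the parity-controlled `X` is its conjugate
by `H` on `i`. Command by command, the operator of a branch is the operator of the circuit followed
by the projection onto the outcomes (`Command.op_mul_outcomeProj`).

The circuit prepares `|+⟩` only on the qubits on which some command acts, as the others are not
accounted for in the size of the pattern. A non-input qubit without commands is not measured and, by
hypothesis, not an output. The Hadamard gate that would prepare it commutes with everything else, so
that it disappears when the qubit is discarded (`sum_outBlock_conj`).

The gates that simulate a command form a circuit of depth at most 5 on the domain of the command,
so two of these circuits share a qubit only if the domains of the commands intersect. A path of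
gates therefore projects to a path of commands, at most 5 times shorter
(`exists_chain_of_sublist_flatMap`). Finally, a signal contains at most `size t` qubits and there
are at most `size t` commands, which makes the size quadratic.
-/

namespace OneWay

/-! ### Operators supported on a set of qubits -/

section Support

variable {V : Type*}

/-- `A` acts on the qubits in `S` only: in the computational basis it does not change the bits
outside `S`, and its entries depend only on the bits in `S`. -/
def SupportedOn (S : Finset V) (A : Matrix (V → Bool) (V → Bool) ℂ) : Prop :=
  (∀ x y, (∃ v, v ∉ S ∧ x v ≠ y v) → A x y = 0) ∧
  ∀ x y x' y', (∀ v, v ∉ S → x v = y v) → (∀ v, v ∉ S → x' v = y' v) →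
    (∀ v ∈ S, x v = x' v) → (∀ v ∈ S, y v = y' v) → A x y = A x' y'

theorem supportedOn_diagonal [Fintype V] {S : Finset V} {d : (V → Bool) → ℂ}
    (hd : ∀ x x', (∀ v ∈ S, x v = x' v) → d x = d x') : SupportedOn S (Matrix.diagonal d) := by
  refine ⟨fun x y ⟨v, _, hv⟩ => Matrix.diagonal_apply_ne _ fun e => hv (congrFun e v),
    fun x y x' y' h1 h2 h3 h4 => ?_⟩
  have hxy : x = y ↔ x' = y' := by
    simp only [funext_iff]
    grind
  simp only [Matrix.diagonal_apply, hxy, hd x x' h3]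

variable [Fintype V] [DecidableEq V]

/-- In the sum for an entry `(x, y)` of a product of operators with disjoint supports, a single
intermediate basis state contributes: `y` on the first support and `x` elsewhere. -/
theorem SupportedOn.mul_apply {S T : Finset V} {A B : Matrix (V → Bool) (V → Bool) ℂ}
    (hA : SupportedOn S A) (hB : SupportedOn T B) (h : Disjoint S T) (x y : V → Bool) :
    (A * B) x y = A x (S.piecewise y x) * B (S.piecewise y x) y := by
  rw [Matrix.mul_apply]
  refine Finset.sum_eq_single _ (fun w _ hw => ?_) (by simp)
  obtain ⟨v, hv⟩ := Function.ne_iff.mp hw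
  by_cases hS : v ∈ S
  · rw [Finset.piecewise_eq_of_mem _ _ _ hS] at hv
    rw [hB.1 w y ⟨v, Finset.disjoint_left.mp h hS, hv⟩, mul_zero]
  · rw [Finset.piecewise_eq_of_notMem _ _ _ hS] at hv
    rw [hA.1 x w ⟨v, hS, hv.symm⟩, zero_mul]

theorem SupportedOn.commute {S T : Finset V} {A B : Matrix (V → Bool) (V → Bool) ℂ}
    (hA : SupportedOn S A) (hB : SupportedOn T B) (h : Disjoint S T) : Commute A B := by
  ext x y
  rw [hA.mul_apply hB h, hB.mul_apply hA h.symm]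
  by_cases hxy : ∀ v, v ∉ S → v ∉ T → x v = y v
  · have hd := Finset.disjoint_left.mp h
    rw [mul_comm]
    congr 1
    · apply hB.2 <;> intro v hv <;> simp only [Finset.piecewise] <;> grind
    · apply hA.2 <;> intro v hv <;> simp only [Finset.piecewise] <;> grind
  · push Not at hxy
    obtain ⟨v, hS, hT, hv⟩ := hxy
    rw [hB.1 (S.piecewise y x) y ⟨v, hT, by simpa [hS] using hv⟩,
      hA.1 (T.piecewise y x) y ⟨v, hS, by simpa [hT] using hv⟩, mul_zero, mul_zero]

theorem supportedOn_onQubit (i : V) (g : Matrix Bool Bool ℂ) :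
    SupportedOn {i} (onQubit i g) := by
  refine ⟨fun x y ⟨v, hv, hxy⟩ => ?_, fun x y x' y' h1 h2 h3 h4 => ?_⟩
  · rw [onQubit, if_neg]
    exact fun h => hxy (h v (by simpa using hv))
  · simp only [Finset.mem_singleton, forall_eq] at h1 h2 h3 h4
    simp only [onQubit]
    rw [if_pos h1, if_pos h2, h3, h4]

theorem supportedOn_ctrlZ (i j : V) : SupportedOn {i, j} (ctrlZ i j) := by
  refine supportedOn_diagonal fun x x' h => ?_
  rw [h i (by simp), h j (by simp)]

theorem supportedOn_fanoutMat (i : V) (T : Finset V) :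
    SupportedOn (insert i T) (fanoutMat i T) := by
  refine ⟨fun x y ⟨v, hv, hxy⟩ => ?_, fun x y x' y' h1 h2 h3 h4 => ?_⟩
  · rw [fanoutMat, if_neg]
    rintro rfl
    exact hxy (if_neg fun h => hv (Finset.mem_insert_of_mem h))
  · have : (x = fun v => if v ∈ T then xor (y v) (y i) else y v) ↔
        x' = fun v => if v ∈ T then xor (y' v) (y' i) else y' v := by
      simp only [funext_iff]
      refine forall_congr' fun v => ?_
      have hi := h4 i (by simp)
      by_cases hv : v ∈ insert i T
      · rw [h3 v hv, h4 v hv, hi]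
      · have hT : v ∉ T := fun h => hv (Finset.mem_insert_of_mem h)
        simp [hT, h1 v hv, h2 v hv]
    simp only [fanoutMat, this]

theorem Gate.supportedOn_op (g : Gate V) : SupportedOn g.qubits g.op := by
  cases g with
  | hadamard i => exact supportedOn_onQubit _ _
  | rz i α => exact supportedOn_onQubit _ _
  | cz i j h => exact supportedOn_ctrlZ i j
  | fanout x T h => exact supportedOn_fanoutMat x T

end Support

/-! ### One-qubit operators -/

section OneQubit

variable {V : Type*} [Fintype V] [DecidableEq V]

/-- An operator on qubit `i` mixes the rows of a matrix that differ in bit `i` only. -/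
theorem onQubit_mul_apply {n : Type*} (i : V) (g : Matrix Bool Bool ℂ)
    (M : Matrix (V → Bool) n ℂ) (x : V → Bool) (y : n) :
    (onQubit i g * M) x y = ∑ b, g (x i) b * M (Function.update x i b) y := by
  rw [Matrix.mul_apply]
  have hinj : Function.Injective fun b => Function.update x i b :=
    Function.update_injective x i
  rw [← Finset.sum_subset (Finset.subset_univ (Finset.univ.image fun b => Function.update x i b)),
    Finset.sum_image fun a _ b _ h => hinj h]
  · refine Finset.sum_congr rfl fun b _ => ?_
    rw [onQubit, if_pos fun v hv => by rw [Function.update_of_ne hv], Function.update_self]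
  · intro w _ hw
    rw [onQubit, if_neg, zero_mul]
    intro h
    refine hw (Finset.mem_image.mpr ⟨w i, Finset.mem_univ _, ?_⟩)
    funext v
    by_cases hv : v = i
    · subst hv
      simp
    · rw [Function.update_of_ne hv, h v hv]

theorem onQubit_mul_onQubit (i : V) (g h : Matrix Bool Bool ℂ) :
    onQubit i g * onQubit i h = onQubit i (g * h) := by
  ext x y
  rw [onQubit_mul_apply]
  have key : ∀ b, (∀ v, v ≠ i → Function.update x i b v = y v) ↔ ∀ v, v ≠ i → x v = y v :=
    fun b => forall₂_congr fun v hv => by rw [Function.update_of_ne hv]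
  simp only [onQubit, key, Function.update_self, Matrix.mul_apply]
  split_ifs <;> simp

theorem onQubit_diagonal (i : V) (d : Bool → ℂ) :
    onQubit i (Matrix.diagonal d) = Matrix.diagonal fun x : V → Bool => d (x i) := by
  ext x y
  simp only [onQubit, Matrix.diagonal_apply]
  by_cases h : x = y
  · subst h
    simp
  · rw [if_neg h]
    split_ifs with h1 h2
    · exact absurd (funext fun v => if hv : v = i then hv ▸ h2 else h1 v hv) h
    · rfl
    · rfl

theorem onQubit_one (i : V) : onQubit i (1 : Matrix Bool Bool ℂ) = 1 := by
  rw [← Matrix.diagonal_one, onQubit_diagonal, Matrix.diagonal_one]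

theorem conjTranspose_onQubit (i : V) (g : Matrix Bool Bool ℂ) :
    (onQubit i g).conjTranspose = onQubit i g.conjTranspose := by
  ext x y
  simp only [onQubit, Matrix.conjTranspose_apply]
  have : (∀ v, v ≠ i → x v = y v) ↔ ∀ v, v ≠ i → y v = x v :=
    forall₂_congr fun v _ => eq_comm
  simp only [this]
  split_ifs <;> simp

theorem inv_sqrt_two_mul_self : (1 / (Real.sqrt 2 : ℂ)) * (1 / (Real.sqrt 2 : ℂ)) = 1 / 2 := by
  rw [div_mul_div_comm, ← Complex.ofReal_mul, Real.mul_self_sqrt (by norm_num)]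
  norm_num

theorem hadamardMat_mul_self : hadamardMat * hadamardMat = 1 := by
  have h := inv_sqrt_two_mul_self
  ext a b
  cases a <;> cases b <;>
    simp only [Matrix.mul_apply, hadamardMat, Fintype.sum_bool, Matrix.one_apply] <;>
    simp <;> simp at h <;> linear_combination 2 * h

theorem conjTranspose_hadamardMat : hadamardMat.conjTranspose = hadamardMat := by
  ext a b
  cases a <;> cases b <;> simp [hadamardMat, Matrix.conjTranspose_apply]

theorem hadamardMat_conj_pauliZ : hadamardMat * pauliZ * hadamardMat = pauliX := by
  have h := inv_sqrt_two_mul_self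
  ext a b
  cases a <;> cases b <;>
    simp only [Matrix.mul_apply, hadamardMat, pauliZ, pauliX, Fintype.sum_bool,
      Matrix.diagonal_apply] <;>
    simp <;> simp at h <;> linear_combination 2 * h

/-- A measurement in the basis `|±_α⟩` is a rotation followed by a measurement in the standard
basis. -/
theorem measMat_eq (α : ℝ) (s : Bool) :
    measMat α s = Matrix.diagonal (fun b => if b = s then 1 else 0) *
      (hadamardMat * rzMat (-α)) := by
  have h : (starRingEnd ℂ) (Complex.exp (Complex.I * α)) = Complex.exp (-(Complex.I * α)) := by
    rw [← Complex.exp_conj]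
    simp
  ext a b
  cases s <;> cases a <;> cases b <;>
    simp [measMat, measVec, hadamardMat, rzMat, Matrix.mul_apply, Matrix.diagonal_apply, h]

end OneQubit

/-! ### Parity of outcomes -/

theorem Command.parity_congr {V : Type*} {x y : V → Bool} {σ : Finset V} (h : ∀ v ∈ σ, x v = y v) :
    parity x σ = parity y σ := by
  rw [parity, parity, Finset.filter_congr fun v hv => by rw [h v hv]]

theorem Command.parity_insert {V : Type*} [DecidableEq V] (x : V → Bool) {j : V} {σ : Finset V}
    (hj : j ∉ σ) :
    parity x (insert j σ) = xor (x j) (parity x σ) := by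
  rw [parity, parity, Finset.filter_insert]
  cases x j
  · simp
  · rw [if_pos rfl, Finset.card_insert_of_notMem (by simp [hj])]
    simp [Nat.odd_add_one, -Nat.not_odd_iff_even]

/-! ### Sequences of gates -/

section Sequences

variable {V : Type u} [Fintype V] [DecidableEq V]

namespace Gate

/-- The operator of a sequence of gates listed in the order of execution. -/
noncomputable def seqOp (l : List (Gate V)) : Matrix (V → Bool) (V → Bool) ℂ :=
  (l.map Gate.op).reverse.prod

@[simp]
theorem seqOp_nil : seqOp ([] : List (Gate V)) = 1 := rfl

@[simp]
theorem seqOp_cons (g : Gate V) (l : List (Gate V)) : seqOp (g :: l) = seqOp l * g.op := by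
  simp [seqOp]

@[simp]
theorem seqOp_append (l l' : List (Gate V)) : seqOp (l ++ l') = seqOp l' * seqOp l := by
  simp [seqOp]

theorem foldl_op_mul {n : Type*} (l : List (Gate V)) (U : Matrix (V → Bool) n ℂ) :
    l.foldl (fun U g => g.op * U) U = seqOp l * U := by
  induction l generalizing U with
  | nil => simp
  | cons g l ih => rw [List.foldl_cons, ih, seqOp_cons, Matrix.mul_assoc]

theorem commute_seqOp {A : Matrix (V → Bool) (V → Bool) ℂ} (l : List (Gate V))
    (h : ∀ g ∈ l, Commute A g.op) : Commute A (seqOp l) := by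
  refine Commute.list_prod_right _ _ fun B hB => ?_
  simp only [List.mem_reverse, List.mem_map] at hB
  obtain ⟨g, hg, rfl⟩ := hB
  exact h g hg

theorem commute_seqOp_hadamard {T : Finset V} {A : Matrix (V → Bool) (V → Bool) ℂ}
    (hA : SupportedOn T A) (l : List V) (h : ∀ j ∈ l, j ∉ T) :
    Commute A (seqOp (l.map hadamard)) := by
  refine commute_seqOp _ fun g hg => ?_
  obtain ⟨j, hj, rfl⟩ := List.mem_map.mp hg
  exact hA.commute (hadamard j).supportedOn_op (Finset.disjoint_singleton_right.mpr (h j hj))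

theorem op_hadamard_mul_self (i : V) : (hadamard i).op * (hadamard i).op = 1 := by
  rw [op, onQubit_mul_onQubit, hadamardMat_mul_self, onQubit_one]

theorem seqOp_hadamard_mul_self {l : List V} (hl : l.Nodup) :
    seqOp (l.map hadamard) * seqOp (l.map hadamard) = 1 := by
  induction l with
  | nil => simp
  | cons j l ih =>
    obtain ⟨hj, hl⟩ := List.nodup_cons.mp hl
    have hc := commute_seqOp_hadamard (hadamard j).supportedOn_op l fun k hk hkj => hj (by
      simp only [qubits, Finset.mem_singleton] at hkj
      exact hkj ▸ hk)
    rw [List.map_cons, seqOp_cons, Matrix.mul_assoc, ← Matrix.mul_assoc _ (seqOp _), hc.eq,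
      Matrix.mul_assoc (seqOp _) (op _) (op _), op_hadamard_mul_self, Matrix.mul_one, ih hl]

theorem conjTranspose_seqOp_hadamard_mul_self (l : List V) :
    (seqOp (l.map hadamard)).conjTranspose * seqOp (l.map hadamard) = 1 := by
  induction l with
  | nil => simp
  | cons j l ih =>
    have h : (hadamard j).op.conjTranspose = (hadamard j).op := by
      rw [op, conjTranspose_onQubit, conjTranspose_hadamardMat]
    rw [List.map_cons, seqOp_cons, Matrix.conjTranspose_mul, h, Matrix.mul_assoc,
      ← Matrix.mul_assoc _ (seqOp _), ih, Matrix.one_mul, op_hadamard_mul_self]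

end Gate

/-! ### Controlled corrections by parity -/

/-- The controlled-`Z` between qubit `i` and the parity of the qubits in `σ`. -/
def parityCtrlZ (i : V) (σ : Finset V) : Matrix (V → Bool) (V → Bool) ℂ :=
  Matrix.diagonal fun x => if x i && Command.parity x σ then -1 else 1

theorem supportedOn_parityCtrlZ (i : V) (σ : Finset V) :
    SupportedOn (insert i σ) (parityCtrlZ i σ) := by
  refine supportedOn_diagonal fun x y h => ?_
  rw [h i (by simp), Command.parity_congr fun v hv => h v (Finset.mem_insert_of_mem hv)]

theorem ctrlZ_mul_parityCtrlZ (i : V) {j : V} {σ : Finset V} (hj : j ∉ σ) :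
    ctrlZ i j * parityCtrlZ i σ = parityCtrlZ i (insert j σ) := by
  rw [ctrlZ, parityCtrlZ, parityCtrlZ, Matrix.diagonal_mul_diagonal]
  congr 1
  funext x
  rw [Command.parity_insert x hj]
  cases x i <;> cases x j <;> cases Command.parity x σ <;> simp

theorem mul_fanoutMat_apply {n : Type*} (M : Matrix n (V → Bool) ℂ) (i : V) (T : Finset V) (x : n)
    (y : V → Bool) :
    (M * fanoutMat i T) x y = M x fun v => if v ∈ T then xor (y v) (y i) else y v := by
  simp [Matrix.mul_apply, fanoutMat]

theorem fanoutMat_insert {i j : V} {T : Finset V} (hi : i ∉ insert j T) (hj : j ∉ T) :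
    fanoutMat i (insert j T) = fanoutMat i {j} * fanoutMat i T := by
  have hij : i ≠ j := fun h => hi (by simp [h])
  have hiT : i ∉ T := fun h => hi (Finset.mem_insert_of_mem h)
  ext x y
  rw [mul_fanoutMat_apply]
  simp only [fanoutMat]
  congr 2
  funext v
  by_cases hvj : v = j
  · subst hvj
    simp [hj, hiT]
  · simp [hvj]

theorem fanoutMat_empty (i : V) : fanoutMat i (∅ : Finset V) = 1 := by
  ext x y
  simp [fanoutMat, Matrix.one_apply]

/-- Conjugation by a Hadamard gate on the target turns a controlled-not into a controlled-`Z`. -/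
theorem hadamard_mul_fanoutMat_singleton {i j : V} (hij : i ≠ j) :
    onQubit j hadamardMat * fanoutMat i {j} = ctrlZ i j * onQubit j hadamardMat := by
  ext x y
  rw [mul_fanoutMat_apply, ctrlZ, Matrix.diagonal_mul]
  simp only [onQubit, Finset.mem_singleton]
  by_cases h : ∀ v, v ≠ j → x v = y v
  · rw [if_pos h, if_pos fun v hv => by rw [if_neg hv, h v hv], h i hij]
    cases x j <;> cases y j <;> cases y i <;> simp [hadamardMat]
  · rw [if_neg h, if_neg, mul_zero]
    exact fun h' => h fun v hv => by rw [h' v hv, if_neg hv]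

/-- Conjugation by Hadamard gates on the targets turns a fan-out gate into a parity-controlled
`Z`. -/
theorem seqOp_hadamard_mul_fanoutMat {i : V} {l : List V} (hl : l.Nodup) (hi : i ∉ l) :
    Gate.seqOp (l.map Gate.hadamard) * fanoutMat i l.toFinset =
      parityCtrlZ i l.toFinset * Gate.seqOp (l.map Gate.hadamard) := by
  induction l with
  | nil =>
    have : parityCtrlZ i (∅ : Finset V) = 1 := by
      simp [parityCtrlZ, Command.parity]
    simp [fanoutMat_empty, this]
  | cons j l ih =>
    obtain ⟨hj, hl⟩ := List.nodup_cons.mp hl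
    obtain ⟨hij, hil⟩ := List.ne_and_not_mem_of_not_mem_cons hi
    have hjl : j ∉ l.toFinset := by simpa using hj
    have hnot : ∀ k ∈ l, k ∉ ({j} : Finset V) := by
      intro k hk hkj
      rw [Finset.mem_singleton] at hkj
      exact hj (hkj ▸ hk)
    have hnot' : ∀ k ∈ l, k ∉ (insert i {j} : Finset V) := by
      intro k hk hkj
      rcases Finset.mem_insert.mp hkj with rfl | h
      · exact hil hk
      · exact hnot k hk h
    have hc1 := (Gate.commute_seqOp_hadamard (supportedOn_onQubit j hadamardMat) l hnot).eq
    have hc2 := (Gate.commute_seqOp_hadamard (supportedOn_fanoutMat i {j}) l hnot').eq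
    have hc3 := ((supportedOn_onQubit j hadamardMat).commute
      (supportedOn_parityCtrlZ i l.toFinset) (by simp [hj, hij.symm])).eq
    rw [List.toFinset_cons, List.map_cons, Gate.seqOp_cons, Gate.op, ← hc1,
      fanoutMat_insert (by simpa using hi) hjl, Matrix.mul_assoc, ← Matrix.mul_assoc (Gate.seqOp _),
      ← hc2, Matrix.mul_assoc (fanoutMat _ _), ih hl hil, ← Matrix.mul_assoc,
      hadamard_mul_fanoutMat_singleton hij, Matrix.mul_assoc, ← Matrix.mul_assoc (onQubit _ _),
      hc3, Matrix.mul_assoc (parityCtrlZ _ _), ← Matrix.mul_assoc,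
      ctrlZ_mul_parityCtrlZ i hjl]

/-! ### The simulation of a command -/

/-- Hadamard gates on the qubits of `S`. -/
noncomputable def hadamards (S : Finset V) : List (Gate V) :=
  S.toList.map Gate.hadamard

/-- A constant-depth implementation of the parity-controlled `Z` by one fan-out gate with source
`i`. It is void if `i ∈ σ`, which well-formedness excludes. -/
noncomputable def parityGates (i : V) (σ : Finset V) : List (Gate V) :=
  if h : i ∈ σ then [] else hadamards σ ++ [Gate.fanout i σ h] ++ hadamards σ

/-- The gates that simulate a command. A measurement is replaced by the rotation of its basis to
the standard one, and corrections are controlled by the qubits that carry the outcomes. -/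
noncomputable def Command.simulate : Command V → List (Gate V)
  | entangle i j h => [Gate.cz i j h]
  | measure i α => [Gate.rz i (-α), Gate.hadamard i]
  | corrX i σ => [Gate.hadamard i] ++ parityGates i σ ++ [Gate.hadamard i]
  | corrZ i σ => parityGates i σ

theorem seqOp_parityGates {i : V} {σ : Finset V} (h : i ∉ σ) :
    Gate.seqOp (parityGates i σ) = parityCtrlZ i σ := by
  have h1 := seqOp_hadamard_mul_fanoutMat (i := i) σ.nodup_toList (by simpa using h)
  rw [Finset.toList_toFinset] at h1
  rw [parityGates, dif_neg h, Gate.seqOp_append, Gate.seqOp_append, Gate.seqOp_cons,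
    Gate.seqOp_nil, one_mul, Gate.op, hadamards, ← Matrix.mul_assoc, h1, Matrix.mul_assoc,
    Gate.seqOp_hadamard_mul_self σ.nodup_toList, mul_one]

/-- The projection onto the basis states in which the qubits of `D` carry the outcomes `s`. -/
def outcomeProj (D : Finset V) (s : V → Bool) : Matrix (V → Bool) (V → Bool) ℂ :=
  Matrix.diagonal fun x => if ∀ v ∈ D, x v = s v then 1 else 0

theorem supportedOn_outcomeProj (D : Finset V) (s : V → Bool) :
    SupportedOn D (outcomeProj D s) := by
  refine supportedOn_diagonal fun x y h => ?_
  have : (∀ v ∈ D, x v = s v) ↔ ∀ v ∈ D, y v = s v :=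
    forall₂_congr fun v hv => by rw [h v hv]
  simp only [this]

/-- Once the control qubits carry the outcomes `s`, the parity-controlled `Z` is the classically
controlled correction. -/
theorem corrZ_op_mul_outcomeProj (s : V → Bool) (i : V) {σ D : Finset V} (hσ : σ ⊆ D) :
    (Command.corrZ i σ).op s * outcomeProj D s = outcomeProj D s * parityCtrlZ i σ := by
  have hop : (Command.corrZ i σ).op s =
      Matrix.diagonal fun x => if x i && Command.parity s σ then -1 else 1 := by
    rw [Command.op, pauliZ, onQubit_diagonal]
    cases Command.parity s σ <;> simp
  rw [hop, outcomeProj, parityCtrlZ, Matrix.diagonal_mul_diagonal, Matrix.diagonal_mul_diagonal]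
  congr 1
  funext x
  by_cases hx : ∀ v ∈ D, x v = s v
  · rw [if_pos hx, mul_one, one_mul, Command.parity_congr fun v hv => (hx v (hσ hv)).symm]
  · rw [if_neg hx, mul_zero, zero_mul]

theorem corrX_op_eq (s : V → Bool) (i : V) (σ : Finset V) :
    (Command.corrX i σ).op s =
      onQubit i hadamardMat * (Command.corrZ i σ).op s * onQubit i hadamardMat := by
  rw [Command.op, Command.op]
  split_ifs
  · rw [onQubit_mul_onQubit, onQubit_mul_onQubit, hadamardMat_conj_pauliZ]
  · rw [mul_one, onQubit_mul_onQubit, hadamardMat_mul_self, onQubit_one]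

/-- The operator of a command is its simulation followed by the projection of the newly measured
qubit: measurements are deferred. -/
theorem Command.op_mul_outcomeProj (s : V → Bool) {D : Finset V} (c : Command V)
    (hq : Disjoint c.qubits D) (hs : c.signal ⊆ D) :
    c.op s * outcomeProj D s = outcomeProj (D ∪ c.measured) s * Gate.seqOp c.simulate := by
  cases c with
  | entangle i j h =>
    simp only [op, simulate, measured, Finset.union_empty, Gate.seqOp_cons, Gate.seqOp_nil,
      one_mul, Gate.op]
    exact ((supportedOn_ctrlZ i j).commute (supportedOn_outcomeProj D s) hq).eq
  | measure i α =>
    have hproj : onQubit i (Matrix.diagonal fun b => if b = s i then 1 else 0) *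
        outcomeProj D s = outcomeProj (D ∪ {i}) s := by
      rw [onQubit_diagonal, outcomeProj, outcomeProj, Matrix.diagonal_mul_diagonal]
      congr 1
      funext x
      have : (∀ v ∈ D ∪ {i}, x v = s v) ↔ x i = s i ∧ ∀ v ∈ D, x v = s v := by
        simp only [Finset.mem_union, Finset.mem_singleton, or_imp, forall_and, forall_eq]
        exact and_comm
      rw [ite_zero_mul_ite_zero, one_mul]
      simp only [this]
    have hc := ((supportedOn_onQubit i (hadamardMat * rzMat (-α))).commute
      (supportedOn_outcomeProj D s) hq).eq
    simp only [op, simulate, measured, Gate.seqOp_cons, Gate.seqOp_nil, one_mul, Gate.op]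
    rw [measMat_eq, ← onQubit_mul_onQubit, Matrix.mul_assoc, hc, ← Matrix.mul_assoc, hproj,
      onQubit_mul_onQubit]
  | corrX i σ =>
    have hi : i ∉ σ := fun h => Finset.disjoint_singleton_left.mp hq (hs h)
    have hc := ((supportedOn_onQubit i hadamardMat).commute
      (supportedOn_outcomeProj D s) hq).eq
    simp only [simulate, measured, Finset.union_empty, Gate.seqOp_append, Gate.seqOp_cons,
      Gate.seqOp_nil, one_mul, seqOp_parityGates hi, Gate.op]
    rw [corrX_op_eq, Matrix.mul_assoc, hc, Matrix.mul_assoc, ← Matrix.mul_assoc (op _ _),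
      corrZ_op_mul_outcomeProj s i (σ := σ) hs, ← Matrix.mul_assoc, ← Matrix.mul_assoc, hc,
      Matrix.mul_assoc, Matrix.mul_assoc]
  | corrZ i σ =>
    have hi : i ∉ σ := fun h => Finset.disjoint_singleton_left.mp hq (hs h)
    simp only [simulate, measured, Finset.union_empty, seqOp_parityGates hi]
    exact corrZ_op_mul_outcomeProj s i hs

theorem foldl_command_op {n : Type*} (s : V → Bool) (O : Finset V) (l : List (Command V))
    (D : Finset V) (h : WellFormedFrom O D l) (U : Matrix (V → Bool) n ℂ) :
    l.foldl (fun U c => c.op s * U) (outcomeProj D s * U) =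
      outcomeProj (D ∪ l.foldr (fun c D => c.measured ∪ D) ∅) s *
        (Gate.seqOp (l.flatMap Command.simulate) * U) := by
  induction l generalizing D U with
  | nil => simp
  | cons c l ih =>
    obtain ⟨hq, -, hs, hl⟩ := h
    rw [List.foldl_cons, ← Matrix.mul_assoc, c.op_mul_outcomeProj s hq hs, Matrix.mul_assoc,
      ih _ hl, List.flatMap_cons, Gate.seqOp_append, List.foldr_cons, Finset.union_assoc,
      Matrix.mul_assoc]

end Sequences

/-! ### Preparation of the register -/

section Preparation

variable {V : Type u} [Fintype V] [DecidableEq V]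

/-- The preparation of the qubits outside `I` in `|+⟩` if they belong to `S`, and in `|0⟩`
otherwise. -/
noncomputable def preparePlus (I S : Finset V) : Matrix (V → Bool) (I → Bool) ℂ :=
  fun x y => if ∀ i : I, x i = y i then
    ∏ v ∈ Iᶜ, if v ∈ S then 1 / (Real.sqrt 2 : ℂ) else if x v then 0 else 1 else 0

theorem preparePlus_empty (I : Finset V) :
    preparePlus I ∅ = prepare I fun b => if b then 0 else 1 := by
  ext x y
  simp [preparePlus, prepare]

theorem preparePlus_compl (I : Finset V) :
    preparePlus I Iᶜ = prepare I fun _ => 1 / (Real.sqrt 2 : ℂ) := by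
  ext x y
  rw [preparePlus, prepare]
  split_ifs
  · refine Finset.prod_congr rfl fun v hv => ?_
    rfl
  · rfl

theorem hadamard_mul_preparePlus {I S : Finset V} {u : V} (hI : u ∉ I) (hS : u ∉ S) :
    onQubit u hadamardMat * preparePlus I S = preparePlus I (insert u S) := by
  ext x y
  have hu : u ∈ Iᶜ := Finset.mem_compl.mpr hI
  have hiff : ∀ b, (∀ i : I, Function.update x u b i = y i) ↔ ∀ i : I, x i = y i := fun b =>
    forall_congr' fun i => by rw [Function.update_of_ne fun h : (i : V) = u => hI (h ▸ i.2)]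
  have hprod : ∀ (b : Bool), (∏ v ∈ Iᶜ.erase u, if v ∈ S then 1 / (Real.sqrt 2 : ℂ) else
      if Function.update x u b v then 0 else 1) =
      ∏ v ∈ Iᶜ.erase u, if v ∈ insert u S then 1 / (Real.sqrt 2 : ℂ) else
        if x v then 0 else 1 := fun b =>
    Finset.prod_congr rfl fun v hv => by
      have hvu := Finset.ne_of_mem_erase hv
      simp [hvu]
  rw [onQubit_mul_apply]
  simp only [preparePlus, hiff, ← Finset.mul_prod_erase _ _ hu, hprod]
  cases h : x u <;> simp [hS, hadamardMat]

theorem seqOp_hadamard_mul_preparePlus {I S : Finset V} {l : List V} (hl : l.Nodup)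
    (hI : ∀ u ∈ l, u ∉ I) (hS : ∀ u ∈ l, u ∉ S) :
    Gate.seqOp (l.map Gate.hadamard) * preparePlus I S = preparePlus I (S ∪ l.toFinset) := by
  induction l generalizing S with
  | nil => simp
  | cons u l ih =>
    obtain ⟨hu, hl⟩ := List.nodup_cons.mp hl
    rw [List.map_cons, Gate.seqOp_cons, Matrix.mul_assoc, Gate.op,
      hadamard_mul_preparePlus (hI u (by simp)) (hS u (by simp)),
      ih hl (fun v hv => hI v (by simp [hv]))]
    · rw [List.toFinset_cons, Finset.insert_union, Finset.union_insert]
    · intro v hv h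
      rcases Finset.mem_insert.mp h with rfl | h
      · exact hu hv
      · exact hS v (by simp [hv]) h

theorem seqOp_hadamards_mul_preparePlus {I S T : Finset V} (hI : Disjoint T I)
    (hS : Disjoint T S) :
    Gate.seqOp (hadamards T) * preparePlus I S = preparePlus I (S ∪ T) := by
  rw [hadamards, seqOp_hadamard_mul_preparePlus T.nodup_toList, Finset.toList_toFinset]
  · exact fun u hu => Finset.disjoint_left.mp hI (Finset.mem_toList.mp hu)
  · exact fun u hu => Finset.disjoint_left.mp hS (Finset.mem_toList.mp hu)

end Preparation

/-! ### Discarded qubits -/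

section Discarded

theorem merge_of_mem {V : Type*} [DecidableEq V] {O : Finset V} (y : O → Bool)
    (z : {v // v ∉ O} → Bool) (v : O) :
    merge O y z v = y v := by
  simp [merge]

theorem merge_of_notMem {V : Type*} [DecidableEq V] {O : Finset V} (y : O → Bool)
    (z : {v // v ∉ O} → Bool) {v : V}
    (hv : v ∉ O) : merge O y z v = z ⟨v, hv⟩ := by
  simp [merge, hv]

variable {V : Type u} [Fintype V] [DecidableEq V]

/-- The observable whose expectation value in the state `M` is the entry `(y, y')` of the sum of
`outBlock O z M` over the outcomes `z` that agree with `s` on `D`. -/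
def outcomeObs (O D : Finset V) (s : V → Bool) (y y' : O → Bool) :
    Matrix (V → Bool) (V → Bool) ℂ :=
  fun b a => if (∀ v : O, b v = y' v) ∧ (∀ v : O, a v = y v) ∧ (∀ v, v ∉ O → b v = a v) ∧
    ∀ v ∈ D, b v = s v then 1 else 0

theorem supportedOn_outcomeObs (O D : Finset V) (s : V → Bool) (y y' : O → Bool) :
    SupportedOn (O ∪ D) (outcomeObs O D s y y') := by
  refine ⟨fun b a ⟨v, hv, hne⟩ => ?_, fun b a b' a' h1 h2 h3 h4 => ?_⟩
  · rw [outcomeObs, if_neg]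
    exact fun h => hne (h.2.2.1 v fun hO => hv (Finset.mem_union_left _ hO))
  · have e1 : (∀ v : O, b v = y' v) ↔ ∀ v : O, b' v = y' v :=
      forall_congr' fun v => by rw [h3 v (Finset.mem_union_left _ v.2)]
    have e2 : (∀ v : O, a v = y v) ↔ ∀ v : O, a' v = y v :=
      forall_congr' fun v => by rw [h4 v (Finset.mem_union_left _ v.2)]
    have e3 : (∀ v, v ∉ O → b v = a v) ↔ ∀ v, v ∉ O → b' v = a' v :=
      forall₂_congr fun v _ => by
        by_cases hv : v ∈ O ∪ D
        · rw [h3 v hv, h4 v hv]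
        · simp [h1 v hv, h2 v hv]
    have e4 : (∀ v ∈ D, b v = s v) ↔ ∀ v ∈ D, b' v = s v :=
      forall₂_congr fun v hv => by rw [h3 v (Finset.mem_union_right _ hv)]
    simp only [outcomeObs, e1, e2, e3, e4]

theorem sum_outBlock_apply {O D : Finset V} (hD : Disjoint D O) (s : V → Bool)
    (M : Matrix (V → Bool) (V → Bool) ℂ) (y y' : O → Bool) :
    (∑ z : {v // v ∉ O} → Bool with ∀ v (h : v ∉ O), v ∈ D → z ⟨v, h⟩ = s v, outBlock O z M) y y' =
      (M * outcomeObs O D s y y').trace := by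
  rw [Matrix.sum_apply, Matrix.trace]
  simp only [Matrix.diag_apply, Matrix.mul_apply]
  rw [← Fintype.sum_prod_type', ← Finset.sum_subset (Finset.subset_univ
    (((Finset.univ : Finset ({v // v ∉ O} → Bool)).filter
      fun z => ∀ v (h : v ∉ O), v ∈ D → z ⟨v, h⟩ = s v).image
        fun z => (merge O y z, merge O y' z))), Finset.sum_image]
  · refine Finset.sum_congr rfl fun z hz => ?_
    rw [outcomeObs, if_pos, mul_one]
    · rfl
    · refine ⟨merge_of_mem y' z, merge_of_mem y z, fun v hv => ?_, fun v hv => ?_⟩ <;> dsimp only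
      · rw [merge_of_notMem _ _ hv, merge_of_notMem _ _ hv]
      · have hvO := Finset.disjoint_left.mp hD hv
        rw [merge_of_notMem _ _ hvO]
        exact (Finset.mem_filter.mp hz).2 v hvO hv
  · intro z _ z' _ h
    funext v
    have := congrFun (congrArg Prod.fst h) v
    dsimp only at this
    rwa [merge_of_notMem _ _ v.2, merge_of_notMem _ _ v.2] at this
  · rintro ⟨a, b⟩ - hab
    rw [outcomeObs, if_neg, mul_zero]
    rintro ⟨hb, ha, hba, hs⟩
    dsimp only at hb ha hba hs
    refine hab (Finset.mem_image.mpr ⟨fun v => a v, Finset.mem_filter.mpr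
      ⟨Finset.mem_univ _, fun v hv hvD => ?_⟩, ?_⟩)
    · exact (hba v hv).symm.trans (hs v hvD)
    · refine Prod.ext ?_ ?_ <;> funext v <;> by_cases hv : v ∈ O <;> dsimp only
      · exact (merge_of_mem y _ ⟨v, hv⟩).trans (ha ⟨v, hv⟩).symm
      · exact merge_of_notMem y _ hv
      · exact (merge_of_mem y' _ ⟨v, hv⟩).trans (hb ⟨v, hv⟩).symm
      · exact (merge_of_notMem y' _ hv).trans (hba v hv).symm

/-- Conjugation by an isometry that acts neither on the outputs nor on the observed qubits does
not change the output states. That `A` acts on `T` only is expressed by its commuting with all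
operators supported off `T`. -/
theorem sum_outBlock_conj {O D T : Finset V} (hD : Disjoint D O) (s : V → Bool)
    {A : Matrix (V → Bool) (V → Bool) ℂ} (hA : ∀ S (B : Matrix (V → Bool) (V → Bool) ℂ),
      SupportedOn S B → Disjoint S T → Commute A B) (hT : Disjoint (O ∪ D) T)
    (hAA : A.conjTranspose * A = 1) (M : Matrix (V → Bool) (V → Bool) ℂ) :
    (∑ z : {v // v ∉ O} → Bool with ∀ v (h : v ∉ O), v ∈ D → z ⟨v, h⟩ = s v,
        outBlock O z (A * M * A.conjTranspose)) =
      ∑ z : {v // v ∉ O} → Bool with ∀ v (h : v ∉ O), v ∈ D → z ⟨v, h⟩ = s v, outBlock O z M := by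
  ext y y'
  rw [sum_outBlock_apply hD, sum_outBlock_apply hD, Matrix.mul_assoc, Matrix.mul_assoc,
    Matrix.trace_mul_comm, Matrix.mul_assoc, Matrix.mul_assoc,
    ← (hA _ _ (supportedOn_outcomeObs O D s y y') hT).eq, ← Matrix.mul_assoc A.conjTranspose, hAA,
    Matrix.one_mul]

theorem traceOut_outcomeProj {O D : Finset V} (hD : Disjoint D O) (s : V → Bool)
    (M : Matrix (V → Bool) (V → Bool) ℂ) :
    traceOut O (outcomeProj D s * M * outcomeProj D s) =
      ∑ z : {v // v ∉ O} → Bool with ∀ v (h : v ∉ O), v ∈ D → z ⟨v, h⟩ = s v, outBlock O z M := by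
  rw [traceOut, Finset.sum_filter]
  refine Finset.sum_congr rfl fun z _ => ?_
  have hiff : ∀ y : O → Bool, (∀ v ∈ D, merge O y z v = s v) ↔
      ∀ v (h : v ∉ O), v ∈ D → z ⟨v, h⟩ = s v := by
    refine fun y => ⟨fun h v hv hvD => ?_, fun h v hvD => ?_⟩
    · rw [← h v hvD, merge_of_notMem _ _ hv]
    · have hv := Finset.disjoint_left.mp hD hvD
      rw [merge_of_notMem _ _ hv, h v hv hvD]
  ext y y'
  rw [outBlock, Matrix.submatrix_apply, outcomeProj, Matrix.mul_diagonal, Matrix.diagonal_mul]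
  simp only [hiff]
  split_ifs
  · rw [one_mul, mul_one]
    rfl
  · simp

end Discarded

/-! ### Depth -/

section Depth

variable {α β V : Type*} [DecidableEq V]

theorem exists_length_eq_pathDepth (dom : α → Finset V) (l : List α) :
    ∃ p : List α, p.Sublist l ∧ p.IsChain (fun a b => (dom a ∩ dom b).Nonempty) ∧
      p.length = pathDepth dom l :=
  (pathDepth_isGreatest dom l).1

theorem length_le_pathDepth {dom : α → Finset V} {l p : List α} (hp : p.Sublist l)
    (hc : p.IsChain fun a b => (dom a ∩ dom b).Nonempty) : p.length ≤ pathDepth dom l :=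
  (pathDepth_isGreatest dom l).2 ⟨p, hp, hc, rfl⟩

theorem pathDepth_le_length (dom : α → Finset V) (l : List α) :
    pathDepth dom l ≤ l.length := by
  obtain ⟨p, hp, -, h⟩ := exists_length_eq_pathDepth dom l
  exact h ▸ hp.length_le

theorem pathDepth_append_le (dom : α → Finset V) (l l' : List α) :
    pathDepth dom (l ++ l') ≤ pathDepth dom l + pathDepth dom l' := by
  obtain ⟨p, hp, hc, h⟩ := exists_length_eq_pathDepth dom (l ++ l')
  obtain ⟨p₁, p₂, rfl, h₁, h₂⟩ := List.sublist_append_iff.mp hp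
  rw [← h, List.length_append]
  exact Nat.add_le_add (length_le_pathDepth h₁ hc.left_of_append)
    (length_le_pathDepth h₂ hc.right_of_append)

/-- Operations with pairwise disjoint domains can be performed in parallel. -/
theorem pathDepth_le_one {dom : α → Finset V} {l : List α}
    (h : l.Pairwise fun a b => Disjoint (dom a) (dom b)) : pathDepth dom l ≤ 1 := by
  obtain ⟨p, hp, hc, hl⟩ := exists_length_eq_pathDepth dom l
  rw [← hl]
  rcases p with _ | ⟨a, _ | ⟨b, p⟩⟩
  · simp
  · simp
  · have hab := (List.pairwise_cons.mp (h.sublist hp)).1 b (by simp)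
    have := (List.isChain_cons_cons.mp hc).1
    rw [Finset.disjoint_iff_inter_eq_empty.mp hab] at this
    exact absurd this Finset.not_nonempty_empty

theorem one_le_pathDepth {dom : α → Finset V} {l : List α} (h : l ≠ []) :
    1 ≤ pathDepth dom l := by
  obtain ⟨a, l, rfl⟩ := List.exists_cons_of_ne_nil h
  exact length_le_pathDepth (p := [a]) (by simp) (List.isChain_singleton a)

/-- A path through the expansions `f c` of the elements `c` of `l` projects to a path in `l`, whose
first element is the one whose expansion contains the start of the path. -/
theorem exists_chain_of_sublist_flatMap {dom : α → Finset V} {dom' : β → Finset V}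
    {f : α → List β} {k : ℕ} (hf : ∀ c, ∀ g ∈ f c, dom' g ⊆ dom c)
    (hk : ∀ c, pathDepth dom' (f c) ≤ k) (l : List α) (p : List β) (hp : p.Sublist (l.flatMap f))
    (hc : p.IsChain fun a b => (dom' a ∩ dom' b).Nonempty) :
    ∃ q : List α, q.Sublist l ∧ q.IsChain (fun a b => (dom a ∩ dom b).Nonempty) ∧
      p.length ≤ k * q.length ∧ ∀ g ∈ p.head?, ∃ c ∈ q.head?, dom' g ⊆ dom c := by
  induction l generalizing p with
  | nil =>
    rw [List.flatMap_nil, List.sublist_nil] at hp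
    subst hp
    exact ⟨[], List.nil_sublist _, List.isChain_nil, by simp, by simp⟩
  | cons c l ih =>
    rw [List.flatMap_cons] at hp
    obtain ⟨p₁, p₂, rfl, h₁, h₂⟩ := List.sublist_append_iff.mp hp
    obtain ⟨q, hq, hqc, hlen, hhead⟩ := ih p₂ h₂ hc.right_of_append
    have hlen₁ := (length_le_pathDepth h₁ hc.left_of_append).trans (hk c)
    rcases p₁.eq_nil_or_concat with rfl | ⟨p₀, b, rfl⟩
    · exact ⟨q, hq.cons c, hqc, by simpa using hlen, by simpa using hhead⟩
    · have hstart : ∀ g ∈ ((p₀.concat b) ++ p₂).head?, dom' g ⊆ dom c := by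
        intro g hg
        refine hf c g (h₁.subset ?_)
        cases p₀ <;> simp_all
      have hb : dom' b ⊆ dom c := hf c b (h₁.subset (by simp))
      rcases p₂ with _ | ⟨b', p₂⟩
      · exact ⟨[c], by simp, List.isChain_singleton c, by simpa using hlen₁,
          fun g hg => ⟨c, by simp, hstart g hg⟩⟩
      · refine ⟨c :: q, hq.cons_cons c, List.isChain_cons.mpr ⟨fun c' hc' => ?_, hqc⟩, ?_,
          fun g hg => ⟨c, by simp, hstart g hg⟩⟩
        · obtain ⟨c'', hc'', hb'⟩ := hhead b' (by simp)
          obtain rfl := Option.mem_unique hc' hc''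
          exact ((List.isChain_append.mp hc).2.2 b (by simp) b' (by simp)).mono
            (Finset.inter_subset_inter hb hb')
        · rw [List.length_append, List.length_cons (a := c), Nat.mul_succ]
          omega

theorem pathDepth_flatMap_le {dom : α → Finset V} {dom' : β → Finset V} {f : α → List β} {k : ℕ}
    (hf : ∀ c, ∀ g ∈ f c, dom' g ⊆ dom c) (hk : ∀ c, pathDepth dom' (f c) ≤ k) (l : List α) :
    pathDepth dom' (l.flatMap f) ≤ k * pathDepth dom l := by
  obtain ⟨p, hp, hc, h⟩ := exists_length_eq_pathDepth dom' (l.flatMap f)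
  obtain ⟨q, hq, hqc, hlen, -⟩ := exists_chain_of_sublist_flatMap hf hk l p hp hc
  rw [← h]
  exact hlen.trans (Nat.mul_le_mul_left k (length_le_pathDepth hq hqc))

end Depth

/-! ### Depth of the simulation -/

section SimulationCost

variable {V : Type u} [DecidableEq V]

theorem pathDepth_hadamards_le (S : Finset V) : pathDepth Gate.qubits (hadamards S) ≤ 1 := by
  refine pathDepth_le_one (List.pairwise_map.mpr (S.nodup_toList.imp fun h => ?_))
  exact Finset.disjoint_singleton.mpr h

theorem pathDepth_parityGates_le (i : V) (σ : Finset V) :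
    pathDepth Gate.qubits (parityGates i σ) ≤ 3 := by
  rw [parityGates]
  split_ifs with h
  · exact (pathDepth_le_length _ _).trans (by simp)
  · exact (pathDepth_append_le _ _ _).trans (Nat.add_le_add ((pathDepth_append_le _ _ _).trans
      (Nat.add_le_add (pathDepth_hadamards_le σ) (pathDepth_le_length _ _)))
      (pathDepth_hadamards_le σ))

theorem Command.pathDepth_simulate_le (c : Command V) :
    pathDepth Gate.qubits c.simulate ≤ 5 := by
  cases c with
  | entangle i j h => exact (pathDepth_le_length _ _).trans (by simp [simulate])
  | measure i α => exact (pathDepth_le_length _ _).trans (by simp [simulate])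
  | corrX i σ =>
    exact (pathDepth_append_le _ _ _).trans (Nat.add_le_add ((pathDepth_append_le _ _ _).trans
      (Nat.add_le_add (pathDepth_le_length _ _) (pathDepth_parityGates_le i σ)))
      (pathDepth_le_length _ _))
  | corrZ i σ => exact (pathDepth_parityGates_le i σ).trans (by simp)

theorem qubits_subset_of_mem_parityGates {i : V} {σ : Finset V} {g : Gate V}
    (hg : g ∈ parityGates i σ) : g.qubits ⊆ insert i σ := by
  have hH : ∀ g ∈ hadamards σ, g.qubits ⊆ insert i σ := by
    intro g hg
    obtain ⟨j, hj, rfl⟩ := List.mem_map.mp hg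
    exact Finset.singleton_subset_iff.mpr (Finset.mem_insert_of_mem (Finset.mem_toList.mp hj))
  rw [parityGates] at hg
  split_ifs at hg with h
  · simp at hg
  · simp only [List.mem_append, List.mem_singleton] at hg
    rcases hg with (hg | rfl) | hg
    · exact hH g hg
    · exact subset_rfl
    · exact hH g hg

theorem Command.qubits_subset_of_mem_simulate (c : Command V) (g : Gate V) (hg : g ∈ c.simulate) :
    g.qubits ⊆ c.dom := by
  cases c with
  | entangle i j h =>
    rw [List.mem_singleton.mp hg]
    exact subset_rfl
  | measure i α =>
    simp only [simulate, List.mem_cons, List.not_mem_nil, or_false] at hg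
    rcases hg with rfl | rfl <;> exact subset_rfl
  | corrX i σ =>
    simp only [simulate, List.mem_append, List.mem_singleton] at hg
    rcases hg with (rfl | hg) | rfl
    · exact Finset.singleton_subset_iff.mpr (Finset.mem_insert_self i σ)
    · exact qubits_subset_of_mem_parityGates hg
    · exact Finset.singleton_subset_iff.mpr (Finset.mem_insert_self i σ)
  | corrZ i σ => exact qubits_subset_of_mem_parityGates hg

/-! ### Size -/

/-- The total number of qubits affected by a sequence of gates. -/
def gatesSize (l : List (Gate V)) : ℕ :=
  (l.map fun g => g.qubits.card).sum

theorem gatesSize_append (l l' : List (Gate V)) :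
    gatesSize (l ++ l') = gatesSize l + gatesSize l' := by
  simp [gatesSize]

theorem gatesSize_hadamards (S : Finset V) : gatesSize (hadamards S) = S.card := by
  simp [gatesSize, hadamards, Function.comp_def, Gate.qubits]

theorem gatesSize_parityGates_le (i : V) (σ : Finset V) :
    gatesSize (parityGates i σ) ≤ 3 * σ.card + 1 := by
  rw [parityGates]
  split_ifs with h
  · simp [gatesSize]
  · have : gatesSize [Gate.fanout i σ h] = σ.card + 1 := by
      simp [gatesSize, Gate.qubits, h]
    rw [gatesSize_append, gatesSize_append, gatesSize_hadamards, this]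
    omega

theorem Command.gatesSize_simulate_le (c : Command V) :
    gatesSize c.simulate ≤ 3 * c.signal.card + 3 := by
  cases c with
  | entangle i j h => simp [gatesSize, simulate, Gate.qubits, h]
  | measure i α => simp [gatesSize, simulate, Gate.qubits]
  | corrX i σ =>
    have h := gatesSize_parityGates_le i σ
    have h1 : gatesSize [Gate.hadamard i] = 1 := by simp [gatesSize, Gate.qubits]
    simp only [simulate, gatesSize_append, h1, signal]
    omega
  | corrZ i σ => exact (gatesSize_parityGates_le i σ).trans (by simp [signal])

theorem Command.one_le_card_qubits (c : Command V) : 1 ≤ c.qubits.card := by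
  cases c <;> simp [qubits, Finset.one_le_card]

theorem Command.measured_subset_qubits (c : Command V) : c.measured ⊆ c.qubits := by
  cases c <;> simp [qubits, measured]

theorem gatesSize_flatMap_simulate_le {m : ℕ} (l : List (Command V))
    (h : ∀ c ∈ l, c.signal.card ≤ m) :
    gatesSize (l.flatMap Command.simulate) ≤
      (3 * m + 3) * (l.map fun c => c.qubits.card).sum := by
  induction l with
  | nil => simp [gatesSize]
  | cons c l ih =>
    have h1 := ih fun c hc => h c (by simp [hc])
    have h2 := c.gatesSize_simulate_le
    have h3 := h c (by simp)
    have h4 := Nat.mul_le_mul_left (3 * m + 3) c.one_le_card_qubits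
    rw [List.flatMap_cons, gatesSize_append, List.map_cons, List.sum_cons, Nat.mul_add]
    omega

theorem card_foldr_union_le (f : Command V → Finset V) (hf : ∀ c, f c ⊆ c.qubits)
    (l : List (Command V)) :
    (l.foldr (fun c D => f c ∪ D) ∅).card ≤ (l.map fun c => c.qubits.card).sum := by
  induction l with
  | nil => simp
  | cons c l ih =>
    rw [List.foldr_cons, List.map_cons, List.sum_cons]
    exact (Finset.card_union_le _ _).trans (Nat.add_le_add (Finset.card_le_card (hf c)) ih)

end SimulationCost

/-! ### Well-formed patterns -/

section WellFormed

variable {V : Type u} [DecidableEq V]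

theorem mem_foldr_union {f : Command V → Finset V} {l : List (Command V)} {v : V} :
    v ∈ l.foldr (fun c D => f c ∪ D) ∅ ↔ ∃ c ∈ l, v ∈ f c := by
  induction l with
  | nil => simp
  | cons c l ih => simp [ih]

theorem WellFormedFrom.signal_subset {O D : Finset V} {l : List (Command V)}
    (h : WellFormedFrom O D l) (c : Command V) (hc : c ∈ l) :
    c.signal ⊆ D ∪ l.foldr (fun c D => c.measured ∪ D) ∅ := by
  induction l generalizing D with
  | nil => simp at hc
  | cons c' l ih =>
    rcases List.mem_cons.mp hc with rfl | hc
    · exact h.2.2.1.trans Finset.subset_union_left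
    · rw [List.foldr_cons, ← Finset.union_assoc]
      exact ih h.2.2.2 hc

theorem WellFormedFrom.disjoint_measured {O D : Finset V} {l : List (Command V)}
    (h : WellFormedFrom O D l) (c : Command V) (hc : c ∈ l) : Disjoint c.measured O := by
  induction l generalizing D with
  | nil => simp at hc
  | cons c' l ih =>
    rcases List.mem_cons.mp hc with rfl | hc
    · exact h.2.1
    · exact ih h.2.2.2 hc

theorem WellFormedFrom.disjoint_foldr_measured {O D : Finset V} {l : List (Command V)}
    (h : WellFormedFrom O D l) :
    Disjoint (l.foldr (fun c D => c.measured ∪ D) ∅) O := by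
  refine Finset.disjoint_left.mpr fun v hv => ?_
  obtain ⟨c, hc, hvc⟩ := mem_foldr_union.mp hv
  exact Finset.disjoint_left.mp (h.disjoint_measured c hc) hvc

end WellFormed

/-! ### The circuit of a pattern -/

namespace Pattern

variable {V : Type u} [DecidableEq V]

/-- The qubits that some command acts on. -/
def touched (t : Pattern V) : Finset V :=
  t.commands.foldr (fun c D => c.qubits ∪ D) ∅

theorem card_touched_le (t : Pattern V) : t.touched.card ≤ t.size :=
  card_foldr_union_le _ (fun _ => subset_rfl) _

theorem card_measured_le (t : Pattern V) : t.measured.card ≤ t.size :=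
  card_foldr_union_le _ Command.measured_subset_qubits _

theorem measured_subset_touched (t : Pattern V) : t.measured ⊆ t.touched := fun v hv => by
  obtain ⟨c, hc, hvc⟩ := mem_foldr_union.mp hv
  exact mem_foldr_union.mpr ⟨c, hc, c.measured_subset_qubits hvc⟩

theorem WellFormed.disjoint_measured {t : Pattern V} (h : t.WellFormed) :
    Disjoint t.measured t.outputs :=
  h.disjoint_foldr_measured

theorem WellFormed.signal_subset {t : Pattern V} (h : t.WellFormed) (c : Command V)
    (hc : c ∈ t.commands) : c.signal ⊆ t.measured := by
  have hs := WellFormedFrom.signal_subset h c hc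
  rwa [Finset.empty_union] at hs

theorem WellFormed.dom_subset {t : Pattern V} (h : t.WellFormed) (c : Command V)
    (hc : c ∈ t.commands) : c.dom ⊆ t.touched := by
  have hq : c.qubits ⊆ t.touched := fun v hv => mem_foldr_union.mpr ⟨c, hc, hv⟩
  have hs := (h.signal_subset c hc).trans t.measured_subset_touched
  cases c with
  | entangle i j hij => exact hq
  | measure i α => exact hq
  | corrX i σ => exact Finset.insert_subset (hq (by simp [Command.qubits])) hs
  | corrZ i σ => exact Finset.insert_subset (hq (by simp [Command.qubits])) hs

/-- The simulation of a pattern on its own register: Hadamard gates prepare `|+⟩` on the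
non-input qubits that are used, then the commands are simulated. The unused non-input qubits stay
in `|0⟩`, since preparing them would not be paid for by the size of the pattern. -/
noncomputable def toCircuit (t : Pattern V) : FanoutCircuit V where
  inputs := t.inputs
  outputs := t.outputs
  gates := hadamards (t.touched \ t.inputs) ++ t.commands.flatMap Command.simulate

theorem depth_toCircuit_le (t : Pattern V) : t.toCircuit.depth ≤ 7 * t.depth := by
  have h := (pathDepth_append_le Gate.qubits (hadamards (t.touched \ t.inputs))
    (t.commands.flatMap Command.simulate)).trans (Nat.add_le_add (pathDepth_hadamards_le _)
      (pathDepth_flatMap_le Command.qubits_subset_of_mem_simulate Command.pathDepth_simulate_le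
        t.commands))
  by_cases hl : t.commands = []
  · -- Without commands no qubit is touched, and the circuit is empty.
    have : t.toCircuit.gates = [] := by simp [toCircuit, touched, hl, hadamards]
    rw [FanoutCircuit.depth, this]
    exact (pathDepth_le_length _ _).trans (by simp)
  · have h1 : 1 ≤ t.depth := one_le_pathDepth hl
    change t.toCircuit.depth ≤ 1 + 5 * t.depth at h
    omega

theorem WellFormed.size_toCircuit_le {t : Pattern V} (h : t.WellFormed) :
    t.toCircuit.size ≤ 7 * t.size ^ 2 := by
  have h1 : t.toCircuit.size ≤ t.size + (3 * t.size + 3) * t.size := by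
    refine (gatesSize_append _ _).trans_le (Nat.add_le_add ?_ ?_)
    · rw [gatesSize_hadamards]
      exact (Finset.card_le_card Finset.sdiff_subset).trans t.card_touched_le
    · exact gatesSize_flatMap_simulate_le _ fun c hc =>
        (Finset.card_le_card (h.signal_subset c hc)).trans t.card_measured_le
  have h2 : t.size ≤ t.size ^ 2 := Nat.le_self_pow two_ne_zero _
  calc t.toCircuit.size ≤ t.size + (3 * t.size + 3) * t.size := h1
    _ = 3 * t.size ^ 2 + 4 * t.size := by ring
    _ ≤ 7 * t.size ^ 2 := by omega

variable [Fintype V]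

/-- The outcomes of the measurements as an assignment on the whole register. -/
def extendOutcomes (t : Pattern V) (s : t.measured → Bool) : V → Bool :=
  fun v => if h : v ∈ t.measured then s ⟨v, h⟩ else false

/-- The isometry of the circuit of `t`, with columns indexed by the basis states of the inputs of
`t`. -/
noncomputable def circuitIsometry (t : Pattern V) : Matrix (V → Bool) (t.inputs → Bool) ℂ :=
  t.toCircuit.isometry

/-- Each branch of a pattern is its circuit, up to Hadamard gates on the unused qubits, followed by
the projection onto the outcomes. -/
theorem WellFormed.kraus_eq {t : Pattern V} (h : t.WellFormed) (s : t.measured → Bool) :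
    t.kraus s = outcomeProj t.measured (t.extendOutcomes s) *
      (Gate.seqOp (hadamards (t.touched ∪ t.inputs)ᶜ) * t.circuitIsometry) := by
  have hcomm : Commute (Gate.seqOp (hadamards (t.touched ∪ t.inputs)ᶜ))
      (Gate.seqOp (t.commands.flatMap Command.simulate)) := by
    refine Gate.commute_seqOp _ fun g hg => ?_
    obtain ⟨c, hc, hgc⟩ := List.mem_flatMap.mp hg
    refine (Gate.commute_seqOp_hadamard g.supportedOn_op _ fun j hj hjg => ?_).symm
    rw [Finset.mem_toList, Finset.mem_compl] at hj
    exact hj (Finset.mem_union_left _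
      (h.dom_subset c hc (c.qubits_subset_of_mem_simulate g hgc hjg)))
  have hprep : (prepare t.inputs fun _ => 1 / (Real.sqrt 2 : ℂ)) =
      Gate.seqOp (hadamards (t.touched ∪ t.inputs)ᶜ) *
        (Gate.seqOp (hadamards (t.touched \ t.inputs)) *
          prepare t.inputs fun b => if b then 0 else 1) := by
    rw [← preparePlus_empty, ← preparePlus_compl,
      seqOp_hadamards_mul_preparePlus Finset.sdiff_disjoint (Finset.disjoint_empty_right _),
      seqOp_hadamards_mul_preparePlus]
    · congr 1
      ext v
      simp only [Finset.mem_compl, Finset.mem_union, Finset.mem_sdiff, Finset.notMem_empty]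
      tauto
    · exact Finset.disjoint_left.mpr fun v hv hI =>
        Finset.mem_compl.mp hv (Finset.mem_union_right _ hI)
    · refine Finset.disjoint_left.mpr fun v hv hT => Finset.mem_compl.mp hv ?_
      simp only [Finset.mem_union, Finset.mem_sdiff, Finset.notMem_empty, false_or] at hT
      exact Finset.mem_union_left _ hT.1
  have hfold := foldl_command_op (t.extendOutcomes s) t.outputs t.commands ∅ h
    (prepare t.inputs fun _ => 1 / (Real.sqrt 2 : ℂ))
  have hone : outcomeProj ∅ (t.extendOutcomes s) = 1 := by simp [outcomeProj]
  rw [hone, Matrix.one_mul, Finset.empty_union] at hfold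
  refine hfold.trans ?_
  rw [hprep, ← Matrix.mul_assoc (Gate.seqOp _) (Gate.seqOp _), ← hcomm.eq, Matrix.mul_assoc]
  congr 2
  refine ((Gate.foldl_op_mul _ _).trans ?_).symm
  rw [← Matrix.mul_assoc, ← Gate.seqOp_append]
  rfl

theorem WellFormed.branch_eq {t : Pattern V} (h : t.WellFormed)
    (ht : t.outputs ⊆ t.touched ∪ t.inputs) (s : t.measured → Bool)
    (ρ : Matrix (t.inputs → Bool) (t.inputs → Bool) ℂ) :
    t.branch s ρ = ∑ z : {v // v ∉ t.outputs} → Bool with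
      ∀ v (h : v ∉ t.outputs), v ∈ t.measured → z ⟨v, h⟩ = t.extendOutcomes s v,
        outBlock t.outputs z
          (t.circuitIsometry * ρ * t.circuitIsometry.conjTranspose) := by
  have hstar : (outcomeProj t.measured (t.extendOutcomes s)).conjTranspose =
      outcomeProj t.measured (t.extendOutcomes s) := by
    rw [outcomeProj, Matrix.diagonal_conjTranspose]
    congr 1
    funext x
    simp [apply_ite]
  rw [← sum_outBlock_conj (T := (t.touched ∪ t.inputs)ᶜ)
    (A := Gate.seqOp (hadamards (t.touched ∪ t.inputs)ᶜ)) h.disjoint_measured _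
    (fun S B hB hS => (Gate.commute_seqOp_hadamard hB _ fun j hj hjS =>
      Finset.disjoint_left.mp hS hjS (Finset.mem_toList.mp hj)).symm)
    (disjoint_compl_right_iff.mpr (Finset.union_subset ht
      (t.measured_subset_touched.trans Finset.subset_union_left)))
    (Gate.conjTranspose_seqOp_hadamard_mul_self _), ← traceOut_outcomeProj h.disjoint_measured]
  rw [branch, h.kraus_eq, Matrix.conjTranspose_mul, Matrix.conjTranspose_mul, hstar]
  simp only [Matrix.mul_assoc]

theorem WellFormed.toCircuit_implements {t : Pattern V} (h : t.WellFormed)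
    (ht : t.outputs ⊆ t.touched ∪ t.inputs) : t.toCircuit.Implements t := by
  have hd : ∀ j ∈ t.measured, j ∉ t.outputs := fun j hj =>
    Finset.disjoint_left.mp h.disjoint_measured hj
  refine ⟨Equiv.refl _, Equiv.refl _, ⟨fun j => ⟨j, hd j j.2⟩, fun j k hjk =>
    Subtype.ext (congrArg (fun w : {w // w ∉ t.outputs} => (w : V)) hjk)⟩, fun s ρ => ?_⟩
  refine (h.branch_eq ht s ρ).trans ?_
  refine Finset.sum_congr (Finset.filter_congr fun z _ => ?_) fun z _ => rfl
  refine ⟨fun hz j => ?_, fun hz v hv hvm => ?_⟩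
  · refine (hz j (hd j j.2) j.2).trans ?_
    rw [extendOutcomes, dif_pos j.2]
  · rw [extendOutcomes, dif_pos hvm]
    exact hz ⟨v, hvm⟩

end Pattern

end OneWay

theorem mainTheorem2 :
    ∃ C : ℕ, ∀ (V : Type u) [Fintype V] [DecidableEq V] (t : OneWay.Pattern V),
      t.WellFormed →
      (∀ v ∈ t.outputs \ t.inputs, ∃ c ∈ t.commands, v ∈ c.qubits) →
      ∃ (W : Type u) (_ : Fintype W) (_ : DecidableEq W) (c : OneWay.FanoutCircuit W),
        c.Implements t ∧ c.depth ≤ C * t.depth ∧ c.size ≤ C * t.size ^ 2 := by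
  refine ⟨7, fun V _ _ t h ht => ⟨V, inferInstance, inferInstance, t.toCircuit,
    h.toCircuit_implements fun v hv => ?_, t.depth_toCircuit_le, h.size_toCircuit_le⟩⟩
  rw [Finset.mem_union, or_iff_not_imp_right]
  exact fun hI => OneWay.mem_foldr_union.mpr (ht v (Finset.mem_sdiff.mpr ⟨hv, hI⟩))
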